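/- Let $r\ge 0$ and $k=(k_1,\dots,k_r)\in\mathbb Z_{\ge 0}^r$, put $|k|=\sum_i k_i$, and let $\mathcal T(k)=\{t^{(i)}_j : 1\le i\le r,\ 1\le j\le k_i\}$ be a set of $|k|$ symbols. *The space $\mathcal A(k)$.* For a set $V$ of symbols and a further symbol $z$, an ordered $p$-forest on $V\cup\{z\}$ is a graph on this vertex set with no cycles, with $p$ edges, and with a numbering of its edges by $1,\dots,p$. Let $\mathcal A^p(V)$ be the complex vector space generated by the ordered $p$-forests on $V\cup\{z\}$ modulo two kinds of relations: (R1) $T_1=-T_2$ if $T_1,T_2$ have the same underlying graph and their numberings differ by a transposition; (R2) $T_1+T_2+T_3=0$ if the three forests agree except for their edges numbered $a\neq b$, and for some vertices $u,v,w$ the edges numbered $a$ and $b$ are respectively $uv,uw$ in $T_1$; $vw,uv$ in $T_2$; $uw,vw$ in $T_3$. The group $G_k=\prod_i\Sigma_{k_i}$ acts on $\mathcal A^{|k|}(\mathcal T(k))$ by permuting the symbols with the same upper index; $\mathcal A(k)$ is the subspace of all $x$ with $\pi x=\mathrm{sgn}(\pi)x$ for all $\pi\in G_k$, and $\mathrm{asym}(x)=\sum_{\pi\in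 G_k}\mathrm{sgn}(\pi)\,\pi(x)$. *Residues.* For $t\in V$ the residue $\mathrm{res}_t:\mathcal A^{p}(V)\to\mathcal A^{p-1}(V\setminus\{t\})$ $(p\ge 1)$ is the linear map which sends a forest $T$ in which $tz$ is the edge number $a$ to $(-1)^{a-1}$ times the forest obtained by contracting this edge to a vertex labelled $z$ and decreasing by $1$ the numbers larger than $a$, and which sends $T$ to $0$ if $tz$ is not an edge of $T$. *Multiindices.* Let $U[k]$ be the component of multidegree $k$ of the free associative complex algebra on $\tilde f_1,\dots,\tilde f_r$ ($\tilde f_i$ having degree $1$ in the $i$-th grading and $0$ in the others). A $k$-multiindex is a map $J:\{1,\dots,|k|\}\to\{1,\dots,r\}$ with $\#J^{-1}(i)=k_i$ for all $i$. Put $\tilde f_J=\tilde f_{J(|k|)}\cdots\tilde f_{J(2)}\tilde f_{J(1)}$; these monomials form a basis of $U[k]$. Let $c$ (depending on $J$) be the map which restricts on each $J^{-1}(i)$ to the increasing bijection onto $\{1,\dots,k_i\}$, and let $\mathrm{sgn}(J)=(-1)^m$, where $m$ is the minimal number of transpositions of neighbouring entries which sort the list $J(1),\dots,J(|k|)$ into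 $1,\dots,1,2,\dots,2,\dots,r,\dots,r$. Let $\langle\ ,\ \rangle: U[k]\times\mathcal A(k)\to\mathbb C$ be the bilinear pairing for which $$\mathrm{sgn}(J)\cdot\mathrm{res}_{t^{(J(|k|))}_{c(|k|)}}\Big(\cdots\mathrm{res}_{t^{(J(2))}_{c(2)}}\big(\mathrm{res}_{t^{(J(1))}_{c(1)}}(x)\big)\cdots\Big)=\langle\tilde f_J,x\rangle\,T_0 ,$$ where $T_0$ is the graph with the single vertex $z$ and no edges. **Theorem.** The pairing $\langle\ ,\ \rangle$ is perfect, i.e. it identifies each of $U[k]$ and $\mathcal A(k)$ with the dual space of the other. Let $\Omega_k=\sum_i b_i^*\otimes b_i\in\mathcal A(k)\otimes U[k]$ be the canonical element, where $(b_i)$ is a basis of $U[k]$ and $(b_i^*)$ is the dual basis of $\mathcal A(k)$ (the result does not depend on the choice of the basis). Then $$\Omega_k=\sum_J \mathrm{sgn}(J)\cdot\mathrm{asym}\Big(z\overset{1}{-}t^{(J(1))}_{c(1)}\overset{2}{-}t^{(J(2))}_{c(2)}\overset{3}{-}\cdots\overset{|k|}{-}t^{(J(|k|))}_{c(|k|)}\Big)\otimes\tilde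 f_J ,$$ where the sum runs over all $k$-multiindices $J$ and the argument of $\mathrm{asym}$ is the path whose edges are numbered as indicated. Moreover, the dual basis of the monomial basis $(\tilde f_J)$ of $U[k]$ is given by $$\tilde f_J^*=\mathrm{sgn}(J)\cdot\mathrm{asym}\Big(z\overset{1}{-}t^{(J(1))}_{c(1)}\overset{2}{-}\cdots\overset{|k|}{-}t^{(J(|k|))}_{c(|k|)}\Big).$$ -/

import Mathlib

open scoped TensorProduct

namespace StringTrees

open SimpleGraph

noncomputable section

/-! ### Ordered forests and the space they generate

The vertex set is `Option V`: the root `z` is `none`, and `some t` is the vertex `t`. -/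

/-- The root vertex `z`. -/
abbrev z {V : Type} : Option V := none

/-- An ordered `p`-forest on the vertex set `V ∪ {z}`: a graph without cycles with `p` (distinct)
edges, numbered by `Fin p` (so the edge with number `a + 1` on paper is `edge a`). -/
@[ext]
structure OrderedForest (V : Type) (p : ℕ) where
  edge : Fin p → Sym2 (Option V)
  injective : Function.Injective edge
  not_isDiag : ∀ i, ¬ (edge i).IsDiag
  acyclic : (fromEdgeSet (Set.range edge)).IsAcyclic

theorem OrderedForest.not_reachable {V : Type} {p : ℕ} (T : OrderedForest V p) {i : Fin p}
    {x y : Option V} (h : T.edge i = s(x, y)) :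
    ¬ (fromEdgeSet (T.edge '' {i}ᶜ)).Reachable x y := by
  have hxy : x ≠ y := fun hh => T.not_isDiag i (by rw [h, hh]; simp)
  have hadj : (fromEdgeSet (Set.range T.edge)).Adj x y := by
    rw [fromEdgeSet_adj]; exact ⟨⟨i, h⟩, hxy⟩
  have hb := isAcyclic_iff_forall_adj_isBridge.1 T.acyclic hadj
  rw [isBridge_iff] at hb
  refine fun hr => hb (hr.mono ?_)
  intro u v huv
  rw [fromEdgeSet_adj] at huv
  obtain ⟨⟨j, hj, hje⟩, hne⟩ := huv
  rw [deleteEdges_adj, fromEdgeSet_adj]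
  refine ⟨⟨⟨j, hje⟩, hne⟩, fun hh => hj ?_⟩
  rw [Set.mem_singleton_iff] at hh
  exact T.injective (by rw [hje, hh, h])

/-- A numbered family of edges such that no edge joins vertices connected by the others
is an ordered forest. -/
def OrderedForest.ofNotReachable {V : Type} {p : ℕ} (e : Fin p → Sym2 (Option V))
    (h : ∀ i x y, e i = s(x, y) → ¬ (fromEdgeSet (e '' {i}ᶜ)).Reachable x y) :
    OrderedForest V p where
  edge := e
  injective := by
    intro i j hij
    by_contra hne
    obtain ⟨x, y, hxy⟩ : ∃ x y, e i = s(x, y) := by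
      induction hE : e i with | _ x y => exact ⟨x, y, rfl⟩
    apply h i x y hxy
    by_cases hd : x = y
    · rw [hd]
    · apply Adj.reachable
      rw [fromEdgeSet_adj]
      exact ⟨⟨j, fun hh => hne hh.symm, by rw [← hij, hxy]⟩, hd⟩
  not_isDiag := by
    intro i hd
    obtain ⟨x, y, hxy⟩ : ∃ x y, e i = s(x, y) := by
      induction hE : e i with | _ x y => exact ⟨x, y, rfl⟩
    rw [hxy, Sym2.mk_isDiag_iff] at hd
    exact h i x y hxy (by rw [hd])
  acyclic := by
    rw [isAcyclic_iff_forall_adj_isBridge]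
    intro x y hxy
    rw [fromEdgeSet_adj] at hxy
    obtain ⟨⟨i, hi⟩, hne⟩ := hxy
    rw [isBridge_iff]
    refine fun hr => h i x y hi (hr.mono ?_)
    intro u v huv
    rw [deleteEdges_adj, fromEdgeSet_adj] at huv
    obtain ⟨⟨⟨j, hj⟩, hne'⟩, hnot⟩ := huv
    rw [fromEdgeSet_adj]
    refine ⟨⟨j, fun hji => hnot ?_, hj⟩, hne'⟩
    rw [Set.mem_singleton_iff] at hji ⊢
    rw [← hj, ← hi, hji]

/-- The relations. First kind: `T₁ + T₂`, where the numberings of the edges of the same graph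
differ by a transposition. Second kind: `T₁ + T₂ + T₃`, where the three forests agree except for
the edges numbered `a` and `b`, which are `uv, uw` in `T₁`, `vw, uv` in `T₂`, and `uw, vw`
in `T₃`. -/
def forestRelations (V : Type) (p : ℕ) : Set (OrderedForest V p →₀ ℂ) :=
  {x | ∃ (T₁ T₂ : OrderedForest V p) (a b : Fin p), a ≠ b ∧
      T₁.edge = T₂.edge ∘ Equiv.swap a b ∧
      x = Finsupp.single T₁ 1 + Finsupp.single T₂ 1} ∪
  {x | ∃ (T₁ T₂ T₃ : OrderedForest V p) (a b : Fin p) (u v w : Option V), a ≠ b ∧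
      (T₁.edge a = s(u, v) ∧ T₁.edge b = s(u, w)) ∧
      (T₂.edge a = s(v, w) ∧ T₂.edge b = s(u, v)) ∧
      (T₃.edge a = s(u, w) ∧ T₃.edge b = s(v, w)) ∧
      (∀ c, c ≠ a → c ≠ b → T₂.edge c = T₁.edge c ∧ T₃.edge c = T₁.edge c) ∧
      x = Finsupp.single T₁ 1 + Finsupp.single T₂ 1 + Finsupp.single T₃ 1}

/-- The complex vector space `𝒜^p` generated by the ordered `p`-forests on `V ∪ {z}` modulo the
two kinds of relations. -/
abbrev ForestSpace (V : Type) (p : ℕ) : Type :=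
  (OrderedForest V p →₀ ℂ) ⧸ Submodule.span ℂ (forestRelations V p)

/-- The class of an ordered forest. -/
def OrderedForest.cls {V : Type} {p : ℕ} (T : OrderedForest V p) : ForestSpace V p :=
  Submodule.Quotient.mk (Finsupp.single T 1)

theorem OrderedForest.cls_add_cls {V : Type} {p : ℕ} {T₁ T₂ : OrderedForest V p} {a b : Fin p}
    (hab : a ≠ b) (h : T₁.edge = T₂.edge ∘ Equiv.swap a b) : T₁.cls + T₂.cls = 0 := by
  rw [cls, cls, ← Submodule.Quotient.mk_add, Submodule.Quotient.mk_eq_zero]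
  exact Submodule.subset_span (Or.inl ⟨T₁, T₂, a, b, hab, h, rfl⟩)

theorem OrderedForest.cls_add_cls_add_cls {V : Type} {p : ℕ} {T₁ T₂ T₃ : OrderedForest V p}
    {a b : Fin p} {u v w : Option V} (hab : a ≠ b)
    (h₁ : T₁.edge a = s(u, v) ∧ T₁.edge b = s(u, w))
    (h₂ : T₂.edge a = s(v, w) ∧ T₂.edge b = s(u, v))
    (h₃ : T₃.edge a = s(u, w) ∧ T₃.edge b = s(v, w))
    (h : ∀ c, c ≠ a → c ≠ b → T₂.edge c = T₁.edge c ∧ T₃.edge c = T₁.edge c) :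
    T₁.cls + T₂.cls + T₃.cls = 0 := by
  rw [cls, cls, cls, ← Submodule.Quotient.mk_add, ← Submodule.Quotient.mk_add,
    Submodule.Quotient.mk_eq_zero]
  exact Submodule.subset_span (Or.inr ⟨T₁, T₂, T₃, a, b, u, v, w, hab, h₁, h₂, h₃, h, rfl⟩)

/-- A linear map out of `ForestSpace V p` is given by its values on forests, provided they satisfy
the relations. -/
def ForestSpace.lift {V : Type} {p : ℕ} {M : Type} [AddCommGroup M] [Module ℂ M]
    (f : OrderedForest V p → M)
    (h₁ : ∀ (T₁ T₂ : OrderedForest V p) (a b : Fin p), a ≠ b →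
      T₁.edge = T₂.edge ∘ Equiv.swap a b → f T₁ + f T₂ = 0)
    (h₂ : ∀ (T₁ T₂ T₃ : OrderedForest V p) (a b : Fin p) (u v w : Option V), a ≠ b →
      (T₁.edge a = s(u, v) ∧ T₁.edge b = s(u, w)) →
      (T₂.edge a = s(v, w) ∧ T₂.edge b = s(u, v)) →
      (T₃.edge a = s(u, w) ∧ T₃.edge b = s(v, w)) →
      (∀ c, c ≠ a → c ≠ b → T₂.edge c = T₁.edge c ∧ T₃.edge c = T₁.edge c) →
      f T₁ + f T₂ + f T₃ = 0) : ForestSpace V p →ₗ[ℂ] M :=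
  Submodule.liftQ _ (Finsupp.linearCombination ℂ f) <| by
    rw [Submodule.span_le]
    rintro x (⟨T₁, T₂, a, b, hab, h, rfl⟩ | ⟨T₁, T₂, T₃, a, b, u, v, w, hab, k₁, k₂, k₃, h, rfl⟩)
    · simpa using h₁ T₁ T₂ a b hab h
    · simpa using h₂ T₁ T₂ T₃ a b u v w hab k₁ k₂ k₃ h

@[simp]
theorem ForestSpace.lift_cls {V : Type} {p : ℕ} {M : Type} [AddCommGroup M] [Module ℂ M]
    (f : OrderedForest V p → M) (h₁) (h₂) (T : OrderedForest V p) :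
    ForestSpace.lift f h₁ h₂ T.cls = f T := by
  simp [ForestSpace.lift, OrderedForest.cls]

/-- Renumbering the edges by a permutation multiplies the class by its sign. -/
theorem OrderedForest.cls_perm {V : Type} {p : ℕ} (π : Equiv.Perm (Fin p)) :
    ∀ T₁ T₂ : OrderedForest V p, T₁.edge = T₂.edge ∘ π →
      T₁.cls = ((Equiv.Perm.sign π : ℤ) : ℂ) • T₂.cls := by
  induction π using Equiv.Perm.swap_induction_on' with
  | one =>
    intro T₁ T₂ h
    have : T₁ = T₂ := OrderedForest.ext (by simpa using h)
    simp [this]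
  | mul_swap π a b hab ih =>
    intro T₁ T₂ h
    let T : OrderedForest V p :=
      { edge := T₂.edge ∘ π
        injective := T₂.injective.comp π.injective
        not_isDiag := fun i => T₂.not_isDiag _
        acyclic := by
          rw [π.surjective.range_comp]; exact T₂.acyclic }
    have e₁ := OrderedForest.cls_add_cls (T₁ := T₁) (T₂ := T) hab (by rw [h]; rfl)
    have e₂ := ih T T₂ rfl
    rw [eq_neg_of_add_eq_zero_left e₁, e₂]
    simp [Equiv.Perm.sign_swap hab]

/-! ### Residues -/

open Classical in
/-- The map on vertices that contracts the edge `tz` to a vertex labelled `z`. -/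
def contractVertex {V : Type} (t : V) : Option V → Option {x : V // x ≠ t}
  | none => none
  | some x => if h : x = t then none else some ⟨x, h⟩

/-- The inclusion of the vertex set `V ∖ {t} ∪ {z}` in `V ∪ {z}`. -/
def includeVertex {V : Type} (t : V) : Option {x : V // x ≠ t} → Option V :=
  Option.map Subtype.val

theorem contractVertex_eq {V : Type} (t : V) (x : Option V) :
    includeVertex t (contractVertex t x) = x ∨
      (includeVertex t (contractVertex t x) = none ∧ x = some t) := by
  cases x with
  | none => left; rfl
  | some x =>
    by_cases h : x = t
    · right; simp [contractVertex, includeVertex, h]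
    · left; simp [contractVertex, includeVertex, h]

/-- Contraction of the edge `tz`, which has number `a`, in an ordered forest: the vertex resulting
from contraction is labelled `z`, the numbers of the edges beyond `a` decrease by one. -/
def OrderedForest.contract {V : Type} {p : ℕ} (T : OrderedForest V (p + 1)) (t : V)
    (a : Fin (p + 1)) (ha : T.edge a = s(z, some t)) : OrderedForest {x : V // x ≠ t} p :=
  OrderedForest.ofNotReachable (fun i => Sym2.map (contractVertex t) (T.edge (a.succAbove i))) <| by
    intro i x y hxy hr
    set G := fromEdgeSet (T.edge '' {a.succAbove i}ᶜ) with hG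
    have hzt : G.Reachable z (some t) := by
      apply Adj.reachable
      rw [hG, fromEdgeSet_adj]
      exact ⟨⟨a, fun h => Fin.succAbove_ne a i h.symm, ha⟩, by simp⟩
    have key : ∀ v, G.Reachable (includeVertex t (contractVertex t v)) v := by
      intro v
      rcases contractVertex_eq t v with h | ⟨h, rfl⟩
      · rw [h]
      · rw [h]; exact hzt
    have lift : ∀ u v, (fromEdgeSet ((fun i => Sym2.map (contractVertex t)
        (T.edge (a.succAbove i))) '' {i}ᶜ)).Reachable u v →
        G.Reachable (includeVertex t u) (includeVertex t v) := by
      rintro u v ⟨W⟩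
      induction W with
      | nil => rfl
      | cons hadj _ ih =>
        refine Reachable.trans ?_ ih
        rw [fromEdgeSet_adj] at hadj
        obtain ⟨⟨j, hj, hje⟩, -⟩ := hadj
        obtain ⟨x', y', hE⟩ : ∃ x' y', T.edge (a.succAbove j) = s(x', y') := by
          induction hE : T.edge (a.succAbove j) with | _ x' y' => exact ⟨x', y', rfl⟩
        have hxy' : G.Reachable x' y' := by
          by_cases hd : x' = y'
          · rw [hd]
          · apply Adj.reachable
            rw [hG, fromEdgeSet_adj]
            exact ⟨⟨_, fun h => hj (Fin.succAbove_right_injective h), hE⟩, hd⟩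
        have hc := ((key x').trans hxy').trans (key y').symm
        simp only [hE, Sym2.map_mk, Sym2.eq_iff] at hje
        rcases hje with ⟨h1, h2⟩ | ⟨h1, h2⟩
        · rwa [h1, h2] at hc
        · rw [h1, h2] at hc; exact hc.symm
    obtain ⟨x', y', hE⟩ : ∃ x' y', T.edge (a.succAbove i) = s(x', y') := by
      induction hE : T.edge (a.succAbove i) with | _ x' y' => exact ⟨x', y', rfl⟩
    apply T.not_reachable hE
    have hl := lift x y hr
    simp only [hE, Sym2.map_mk, Sym2.eq_iff] at hxy
    rcases hxy with ⟨h1, h2⟩ | ⟨h1, h2⟩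
    · rw [← h1, ← h2] at hl
      exact ((key x').symm.trans hl).trans (key y')
    · rw [← h1, ← h2] at hl
      exact ((key x').symm.trans hl.symm).trans (key y')

open Classical in
/-- The residue of an ordered forest at the vertex `t`: if `tz` is the edge with index `a` (that is,
with number `a + 1`), it is `(-1)^a` times the contraction; if `tz` is not an edge, it is `0`. -/
def OrderedForest.residue {V : Type} {p : ℕ} (t : V) (T : OrderedForest V (p + 1)) :
    ForestSpace {x : V // x ≠ t} p :=
  if h : ∃ a, T.edge a = s(z, some t) then
    (-1 : ℂ) ^ (h.choose : ℕ) • (T.contract t h.choose h.choose_spec).cls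
  else 0

theorem OrderedForest.residue_of_edge {V : Type} {p : ℕ} {t : V} {T : OrderedForest V (p + 1)}
    {a : Fin (p + 1)} (ha : T.edge a = s(z, some t)) :
    T.residue t = (-1 : ℂ) ^ (a : ℕ) • (T.contract t a ha).cls := by
  have h : ∃ a, T.edge a = s(z, some t) := ⟨a, ha⟩
  have key : ∀ c (hc : T.edge c = s(z, some t)), (-1 : ℂ) ^ (c : ℕ) • (T.contract t c hc).cls =
      (-1 : ℂ) ^ (a : ℕ) • (T.contract t a ha).cls := by
    intro c hc
    obtain rfl : c = a := T.injective (hc.trans ha.symm)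
    rfl
  rw [OrderedForest.residue, dif_pos h]
  exact key _ h.choose_spec

theorem OrderedForest.residue_of_not {V : Type} {p : ℕ} {t : V} {T : OrderedForest V (p + 1)}
    (h : ∀ a, T.edge a ≠ s(z, some t)) : T.residue t = 0 := by
  rw [OrderedForest.residue, dif_neg (by simpa using h)]

/-- Removing the value `a` at the argument `b` from a permutation `σ` with `σ b = a`. -/
theorem exists_perm_succAbove {p : ℕ} (σ : Equiv.Perm (Fin (p + 1))) (a b : Fin (p + 1))
    (h : σ b = a) : ∃ ρ : Equiv.Perm (Fin p), (∀ j, a.succAbove (ρ j) = σ (b.succAbove j)) ∧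
      ((Equiv.Perm.sign ρ : ℤ) : ℂ) =
        (-1) ^ (a : ℕ) * ((Equiv.Perm.sign σ : ℤ) : ℂ) * (-1) ^ (b : ℕ) := by
  set τ : Equiv.Perm (Fin (p + 1)) := a.cycleRange * σ * b.cycleRange⁻¹ with hτ
  obtain ⟨⟨q, ρ⟩, hρ⟩ := Equiv.Perm.decomposeFin.symm.surjective τ
  have h0 : τ 0 = 0 := by
    simp [hτ, h]
  have hq : q = 0 := by
    rw [← h0, ← hρ, Equiv.Perm.decomposeFin_symm_apply_zero]
  subst hq
  refine ⟨ρ, fun j => ?_, ?_⟩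
  · have h1 : τ j.succ = (ρ j).succ := by
      rw [← hρ, Equiv.Perm.decomposeFin_symm_apply_succ]; simp
    rw [← Fin.cycleRange_symm_succ, ← h1, hτ]
    simp
  · have hs : Equiv.Perm.sign τ = Equiv.Perm.sign ρ := by
      rw [← hρ, Equiv.Perm.decomposeFin.symm_sign]; simp
    rw [← hs, hτ]
    simp [Fin.sign_cycleRange]

/-- Two forests which become equal up to a transposition of the numbers after identifying `t`
with `z`, one of the two transposed edges being `tz`. -/
theorem OrderedForest.residue_add_residue {V : Type} {p : ℕ} {t : V}
    {T₁ T₂ : OrderedForest V (p + 1)} {σ : Equiv.Perm (Fin (p + 1))}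
    (hσ : Equiv.Perm.sign σ = -1) {a b : Fin (p + 1)} (hab : σ b = a)
    (hb : T₁.edge b = s(z, some t)) (ha : T₂.edge a = s(z, some t))
    (h : ∀ i, i ≠ b → Sym2.map (contractVertex t) (T₁.edge i) =
      Sym2.map (contractVertex t) (T₂.edge (σ i))) :
    T₁.residue t + T₂.residue t = 0 := by
  obtain ⟨ρ, hρ, hs⟩ := exists_perm_succAbove σ a b hab
  rw [residue_of_edge hb, residue_of_edge ha,
    cls_perm ρ (T₁.contract t b hb) (T₂.contract t a ha), hs, hσ, smul_smul, ← add_smul]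
  · have : (-1 : ℂ) ^ (b : ℕ) * (-1) ^ (b : ℕ) = 1 := by rw [← mul_pow]; simp
    have e : (-1 : ℂ) ^ (b : ℕ) * ((-1) ^ (a : ℕ) * (((-1 : ℤˣ) : ℤ) : ℂ) * (-1) ^ (b : ℕ)) +
        (-1) ^ (a : ℕ) = (-1) ^ (a : ℕ) * (1 - (-1 : ℂ) ^ (b : ℕ) * (-1) ^ (b : ℕ)) := by
      push_cast [Units.val_neg, Units.val_one]; ring
    rw [e, this]; simp
  · funext i
    change Sym2.map _ (T₁.edge (b.succAbove i)) = Sym2.map _ (T₂.edge (a.succAbove (ρ i)))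
    rw [hρ]
    exact h _ (Fin.succAbove_ne b i)

theorem OrderedForest.residue_swap {V : Type} {p : ℕ} (t : V) (T₁ T₂ : OrderedForest V (p + 1))
    (a b : Fin (p + 1)) (hab : a ≠ b) (h : T₁.edge = T₂.edge ∘ Equiv.swap a b) :
    T₁.residue t + T₂.residue t = 0 := by
  by_cases hc : ∃ c, T₁.edge c = s(z, some t)
  · obtain ⟨c, hc⟩ := hc
    exact residue_add_residue (σ := Equiv.swap a b) (Equiv.Perm.sign_swap hab) rfl hc
      (by rw [← hc, h]; rfl) (fun i _ => by rw [h]; rfl)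
  · have h2 : ∀ c, T₂.edge c ≠ s(z, some t) := by
      intro c hcc
      exact hc ⟨Equiv.swap a b c, by rw [h]; simpa using hcc⟩
    rw [residue_of_not (by simpa using hc), residue_of_not h2, add_zero]

/-- The part of the triangle relation where the contracted edge is an edge of the triangle. -/
theorem OrderedForest.residue_triangle_aux {V : Type} {p : ℕ} (t : V)
    (T₁ T₂ T₃ : OrderedForest V (p + 1)) (a b : Fin (p + 1)) (u v w : Option V) (hab : a ≠ b)
    (h₁ : T₁.edge a = s(u, v) ∧ T₁.edge b = s(u, w))
    (h₂ : T₂.edge a = s(v, w) ∧ T₂.edge b = s(u, v))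
    (h₃ : T₃.edge a = s(u, w) ∧ T₃.edge b = s(v, w))
    (h : ∀ c, c ≠ a → c ≠ b → T₂.edge c = T₁.edge c ∧ T₃.edge c = T₁.edge c)
    (huv : s(u, v) = s(z, some t)) : T₁.residue t + T₂.residue t + T₃.residue t = 0 := by
  have hcon : contractVertex t u = contractVertex t v := by
    have hz : contractVertex t (some t) = contractVertex t none := by simp [contractVertex]
    rcases Sym2.eq_iff.1 huv with ⟨rfl, rfl⟩ | ⟨rfl, rfl⟩
    · exact hz.symm
    · exact hz
  have e3 : T₃.residue t = 0 := by
    apply residue_of_not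
    intro c hc
    rw [← huv] at hc
    have h12 : s(u, v) ≠ s(u, w) := fun hh =>
      hab (T₁.injective (by rw [h₁.1, h₁.2, hh]))
    have h13 : s(u, v) ≠ s(v, w) := fun hh =>
      hab (T₂.injective (by rw [h₂.1, h₂.2, hh]))
    by_cases hca : c = a
    · subst hca; exact h12 (hc.symm.trans h₃.1)
    by_cases hcb : c = b
    · subst hcb; exact h13 (hc.symm.trans h₃.2)
    · exact hca (T₁.injective (by rw [← (h c hca hcb).2, hc, h₁.1]))
  rw [e3, add_zero]
  refine residue_add_residue (σ := Equiv.swap a b) (b := a) (a := b)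
    (Equiv.Perm.sign_swap hab) (Equiv.swap_apply_left a b)
    (h₁.1.trans huv) (h₂.2.trans huv) ?_
  intro i hia
  by_cases hib : i = b
  · subst hib
    rw [Equiv.swap_apply_right, h₁.2, h₂.1, Sym2.map_mk, Sym2.map_mk, hcon]
  · rw [Equiv.swap_apply_of_ne_of_ne hia hib, (h i hia hib).1]

theorem OrderedForest.residue_triangle {V : Type} {p : ℕ} (t : V)
    (T₁ T₂ T₃ : OrderedForest V (p + 1)) (a b : Fin (p + 1)) (u v w : Option V) (hab : a ≠ b)
    (h₁ : T₁.edge a = s(u, v) ∧ T₁.edge b = s(u, w))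
    (h₂ : T₂.edge a = s(v, w) ∧ T₂.edge b = s(u, v))
    (h₃ : T₃.edge a = s(u, w) ∧ T₃.edge b = s(v, w))
    (h : ∀ c, c ≠ a → c ≠ b → T₂.edge c = T₁.edge c ∧ T₃.edge c = T₁.edge c) :
    T₁.residue t + T₂.residue t + T₃.residue t = 0 := by
  by_cases huv : s(u, v) = s(z, some t)
  · exact residue_triangle_aux t T₁ T₂ T₃ a b u v w hab h₁ h₂ h₃ h huv
  by_cases hvw : s(v, w) = s(z, some t)
  · have e := residue_triangle_aux t T₂ T₃ T₁ a b v w u hab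
      ⟨h₂.1, h₂.2.trans Sym2.eq_swap⟩ ⟨h₃.1.trans Sym2.eq_swap, h₃.2⟩
      ⟨h₁.1.trans Sym2.eq_swap, h₁.2.trans Sym2.eq_swap⟩
      (fun c hca hcb => ⟨(h c hca hcb).2.trans (h c hca hcb).1.symm, (h c hca hcb).1.symm⟩) hvw
    rw [← e]; abel
  by_cases huw : s(u, w) = s(z, some t)
  · have e := residue_triangle_aux t T₃ T₁ T₂ a b w u v hab
      ⟨h₃.1.trans Sym2.eq_swap, h₃.2.trans Sym2.eq_swap⟩
      ⟨h₁.1, h₁.2.trans Sym2.eq_swap⟩ ⟨h₂.1.trans Sym2.eq_swap, h₂.2⟩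
      (fun c hca hcb => ⟨(h c hca hcb).2.symm, (h c hca hcb).1.trans (h c hca hcb).2.symm⟩)
      (Sym2.eq_swap.trans huw)
    rw [← e]; abel
  by_cases hd : ∃ d, T₁.edge d = s(z, some t)
  · obtain ⟨d, hd⟩ := hd
    have hda : a ≠ d := fun hh => huv (by rw [← hd, ← hh, h₁.1])
    have hdb : b ≠ d := fun hh => huw (by rw [← hd, ← hh, h₁.2])
    have hd₂ := (h d hda.symm hdb.symm).1.trans hd
    have hd₃ := (h d hda.symm hdb.symm).2.trans hd
    obtain ⟨a', rfl⟩ := Fin.exists_succAbove_eq hda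
    obtain ⟨b', rfl⟩ := Fin.exists_succAbove_eq hdb
    rw [residue_of_edge hd, residue_of_edge hd₂, residue_of_edge hd₃, ← smul_add, ← smul_add,
      cls_add_cls_add_cls (a := a') (b := b') (u := contractVertex t u)
        (v := contractVertex t v) (w := contractVertex t w), smul_zero]
    · exact fun hh => hab (by rw [hh])
    · exact ⟨congrArg (Sym2.map (contractVertex t)) h₁.1,
        congrArg (Sym2.map (contractVertex t)) h₁.2⟩
    · exact ⟨congrArg (Sym2.map (contractVertex t)) h₂.1,
        congrArg (Sym2.map (contractVertex t)) h₂.2⟩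
    · exact ⟨congrArg (Sym2.map (contractVertex t)) h₃.1,
        congrArg (Sym2.map (contractVertex t)) h₃.2⟩
    · intro c hca hcb
      have hc := h (d.succAbove c) (fun hh => hca (Fin.succAbove_right_injective hh))
        (fun hh => hcb (Fin.succAbove_right_injective hh))
      exact ⟨congrArg (Sym2.map (contractVertex t)) hc.1,
        congrArg (Sym2.map (contractVertex t)) hc.2⟩
  · push Not at hd
    have k₂ : ∀ c, T₂.edge c ≠ s(z, some t) := by
      intro c
      by_cases hca : c = a
      · rw [hca, h₂.1]; exact hvw
      by_cases hcb : c = b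
      · rw [hcb, h₂.2]; exact huv
      rw [(h c hca hcb).1]; exact hd c
    have k₃ : ∀ c, T₃.edge c ≠ s(z, some t) := by
      intro c
      by_cases hca : c = a
      · rw [hca, h₃.1]; exact huw
      by_cases hcb : c = b
      · rw [hcb, h₃.2]; exact hvw
      rw [(h c hca hcb).2]; exact hd c
    rw [residue_of_not hd, residue_of_not k₂, residue_of_not k₃]; simp

/-- The residue at the vertex `t`. -/
def ForestSpace.residue {V : Type} {p : ℕ} (t : V) :
    ForestSpace V (p + 1) →ₗ[ℂ] ForestSpace {x : V // x ≠ t} p :=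
  ForestSpace.lift (OrderedForest.residue t) (OrderedForest.residue_swap t)
    (OrderedForest.residue_triangle t)

/-- The coefficient of the edgeless forest. -/
def ForestSpace.constant {V : Type} : ForestSpace V 0 →ₗ[ℂ] ℂ :=
  ForestSpace.lift (fun _ => 1) (fun _ _ a => a.elim0) (fun _ _ _ a => a.elim0)

/-- The iterated residue `res_{σ(n)} (⋯ res_{σ(2)} (res_{σ(1)} x))` along distinct vertices
`σ(1), …, σ(n)`, as a multiple of the edgeless forest. -/
def iteratedResidue : ∀ (n : ℕ) {V : Type}, (Fin n ↪ V) → (ForestSpace V n →ₗ[ℂ] ℂ)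
  | 0, _, _ => ForestSpace.constant
  | n + 1, _, σ =>
    (iteratedResidue n
      ⟨fun i => ⟨σ i.succ, fun h => Fin.succ_ne_zero i (σ.injective h)⟩,
        fun _ _ h => Fin.succ_injective _ (σ.injective (congrArg Subtype.val h))⟩) ∘ₗ
      ForestSpace.residue (σ 0)

/-! ### The action of permutations of the vertices -/

/-- Relabelling the vertices other than `z`. -/
def OrderedForest.relabel {V : Type} {p : ℕ} (π : Equiv.Perm V) (T : OrderedForest V p) :
    OrderedForest V p :=
  OrderedForest.ofNotReachable (fun i => Sym2.map (Option.map π) (T.edge i)) <| by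
    intro i x y hxy hr
    have inv : ∀ v : Option V, Option.map π.symm (Option.map π v) = v := by simp
    have inv2 : ∀ e : Sym2 (Option V),
        Sym2.map (Option.map π.symm) (Sym2.map (Option.map π) e) = e := by
      intro e
      induction e with | _ u v => simp [Sym2.map_mk]
    refine T.not_reachable (i := i) (x := Option.map π.symm x) (y := Option.map π.symm y) ?_ ?_
    · rw [← inv2 (T.edge i), hxy]; rfl
    · refine hr.map ⟨Option.map π.symm, ?_⟩
      intro u v huv
      rw [fromEdgeSet_adj] at huv ⊢
      obtain ⟨⟨j, hj, hje⟩, hne⟩ := huv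
      refine ⟨⟨j, hj, ?_⟩, fun hh => hne (Option.map_injective π.symm.injective hh)⟩
      rw [← inv2 (T.edge j)]
      exact congrArg (Sym2.map (Option.map π.symm)) hje

/-- The action of a permutation of the vertices on `ForestSpace V p`. -/
def ForestSpace.act {V : Type} {p : ℕ} (π : Equiv.Perm V) :
    ForestSpace V p →ₗ[ℂ] ForestSpace V p :=
  ForestSpace.lift (fun T => (T.relabel π).cls)
    (fun _ _ _ _ hab h => OrderedForest.cls_add_cls hab
      (funext fun i => congrArg (Sym2.map (Option.map π)) (congrFun h i)))
    (fun _ _ _ _ _ _ _ _ hab h₁ h₂ h₃ h => OrderedForest.cls_add_cls_add_cls hab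
      ⟨congrArg (Sym2.map (Option.map π)) h₁.1, congrArg (Sym2.map (Option.map π)) h₁.2⟩
      ⟨congrArg (Sym2.map (Option.map π)) h₂.1, congrArg (Sym2.map (Option.map π)) h₂.2⟩
      ⟨congrArg (Sym2.map (Option.map π)) h₃.1, congrArg (Sym2.map (Option.map π)) h₃.2⟩
      (fun c hca hcb => ⟨congrArg (Sym2.map (Option.map π)) (h c hca hcb).1,
        congrArg (Sym2.map (Option.map π)) (h c hca hcb).2⟩))

theorem ForestSpace.act_mul {V : Type} {p : ℕ} (π ρ : Equiv.Perm V) (x : ForestSpace V p) :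
    ForestSpace.act (π * ρ) x = ForestSpace.act π (ForestSpace.act ρ x) := by
  suffices h : (ForestSpace.act (π * ρ) : ForestSpace V p →ₗ[ℂ] _) =
      ForestSpace.act π ∘ₗ ForestSpace.act ρ from LinearMap.congr_fun h x
  apply Submodule.linearMap_qext
  ext T
  change ForestSpace.act (π * ρ) T.cls = ForestSpace.act π (ForestSpace.act ρ T.cls)
  simp only [ForestSpace.act, ForestSpace.lift_cls]
  congr 1
  apply OrderedForest.ext
  funext i
  change Sym2.map _ (T.edge i) = Sym2.map _ (Sym2.map _ (T.edge i))
  rw [Sym2.map_map, Option.map_comp_map]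
  rfl

/-! ### Skew-invariants -/

/-- The set `𝒯(k)` of symbols `t^{(i)}_j`, `1 ≤ i ≤ r`, `1 ≤ j ≤ k_i`. -/
abbrev Symbols {r : ℕ} (k : Fin r → ℕ) : Type := Σ i : Fin r, Fin (k i)

/-- `|k| = ∑ k_i`. -/
abbrev size {r : ℕ} (k : Fin r → ℕ) : ℕ := ∑ i, k i

/-- The group `G_k = ∏ Σ_{k_i}`. -/
abbrev SymGroup {r : ℕ} (k : Fin r → ℕ) : Type := ∀ i : Fin r, Equiv.Perm (Fin (k i))

/-- `sgn(π)` for `π ∈ G_k`. -/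
def permSign {r : ℕ} {k : Fin r → ℕ} (π : SymGroup k) : ℂ :=
  ((∏ i, Equiv.Perm.sign (π i) : ℤˣ) : ℤ)

theorem permSign_mul {r : ℕ} {k : Fin r → ℕ} (π ρ : SymGroup k) :
    permSign (π * ρ) = permSign π * permSign ρ := by
  simp [permSign, Finset.prod_mul_distrib]

theorem permSign_mul_self {r : ℕ} {k : Fin r → ℕ} (π : SymGroup k) :
    permSign π * permSign π = 1 := by
  unfold permSign
  rw [← Int.cast_mul, ← Units.val_mul, Int.units_mul_self]
  simp

/-- The action of `π ∈ G_k`, `t^{(i)}_j ↦ t^{(i)}_{π_i(j)}`, on `ForestSpace (Symbols k) p`. -/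
def groupAct {r : ℕ} {k : Fin r → ℕ} {p : ℕ} (π : SymGroup k) :
    ForestSpace (Symbols k) p →ₗ[ℂ] ForestSpace (Symbols k) p :=
  ForestSpace.act (Equiv.Perm.sigmaCongrRight π)

theorem groupAct_mul {r : ℕ} {k : Fin r → ℕ} {p : ℕ} (π ρ : SymGroup k)
    (x : ForestSpace (Symbols k) p) : groupAct (π * ρ) x = groupAct π (groupAct ρ x) := by
  have h : (Equiv.Perm.sigmaCongrRight (π * ρ) : Equiv.Perm (Symbols k)) =
      Equiv.Perm.sigmaCongrRight π * Equiv.Perm.sigmaCongrRight ρ := rfl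
  rw [groupAct, h, ForestSpace.act_mul]
  rfl

/-- `𝒜(k)`: the skew-invariant subspace. -/
def SkewSpace {r : ℕ} (k : Fin r → ℕ) : Submodule ℂ (ForestSpace (Symbols k) (size k)) where
  carrier := {x | ∀ π : SymGroup k, groupAct π x = permSign π • x}
  add_mem' := by
    intro x y hx hy π
    rw [map_add, hx π, hy π, smul_add]
  zero_mem' := by intro π; simp
  smul_mem' := by
    intro c x hx π
    rw [map_smul, hx π, smul_comm]

/-- Antisymmetrization `∑_{π ∈ G_k} sgn(π) π(x)`. -/
def asym {r : ℕ} {k : Fin r → ℕ} (x : ForestSpace (Symbols k) (size k)) : SkewSpace k :=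
  ⟨∑ π : SymGroup k, permSign π • groupAct π x, by
    intro ρ
    rw [map_sum, Finset.smul_sum]
    refine Fintype.sum_equiv (Equiv.mulLeft ρ) _ _ fun π => ?_
    rw [Equiv.coe_mulLeft, groupAct_mul, permSign_mul, map_smul, smul_smul, ← mul_assoc,
      permSign_mul_self, one_mul]⟩

/-! ### Multiindices, monomials and string trees -/

/-- `k`-multiindices: maps `J : {1, …, |k|} → {1, …, r}` with `#J⁻¹(i) = k_i`. -/
abbrev Multiindex {r : ℕ} (k : Fin r → ℕ) : Type :=
  {J : Fin (size k) → Fin r // ∀ i, (Finset.univ.filter (fun a => J a = i)).card = k i}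

/-- The sign `(-1)^m` of a multiindex, where `m` is the minimal number of transpositions of
neighbouring entries which sort the list `J(1), …, J(|k|)` into non-decreasing order. -/
def Multiindex.sgn {r : ℕ} {k : Fin r → ℕ} (J : Multiindex k) : ℂ :=
  (-1) ^ sInf {m : ℕ | ∃ l : List (Equiv.Perm (Fin (size k))), l.length = m ∧
    (∀ s ∈ l, ∃ a b : Fin (size k), (b : ℕ) = a + 1 ∧ s = Equiv.swap a b) ∧
    Monotone (J.1 ∘ l.prod)}

/-- The symbol `t^{(J(a))}_{c(a)}`, where `c` restricts on each `J⁻¹(i)` to the increasing bijection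
onto `{1, …, k_i}`. -/
def Multiindex.symbol {r : ℕ} {k : Fin r → ℕ} (J : Multiindex k) (a : Fin (size k)) : Symbols k :=
  ⟨J.1 a, ((Finset.univ.filter (fun b => J.1 b = J.1 a)).orderIsoOfFin (J.2 (J.1 a))).symm
    ⟨a, by simp⟩⟩

theorem Multiindex.symbol_injective {r : ℕ} {k : Fin r → ℕ} (J : Multiindex k) :
    Function.Injective J.symbol := by
  have key : ∀ (i j : Fin r) (hij : i = j) (a b : Fin (size k)) (ha : J.1 a = i) (hb : J.1 b = j),
      HEq (((Finset.univ.filter (fun b => J.1 b = i)).orderIsoOfFin (J.2 i)).symm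
        ⟨a, by simpa using ha⟩) (((Finset.univ.filter (fun b => J.1 b = j)).orderIsoOfFin
          (J.2 j)).symm ⟨b, by simpa using hb⟩) → a = b := by
    rintro i _ rfl a b ha hb h
    have := (OrderIso.injective _) (eq_of_heq h)
    exact congrArg Subtype.val this
  intro a b h
  obtain ⟨h1, h2⟩ := Sigma.mk.inj h
  exact key _ _ h1 a b rfl rfl h2

/-- The symbols of a multiindex as a sequence of distinct vertices. -/
def Multiindex.vertices {r : ℕ} {k : Fin r → ℕ} (J : Multiindex k) : Fin (size k) ↪ Symbols k :=
  ⟨J.symbol, J.symbol_injective⟩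

/-- The string tree `z —1— σ(1) —2— σ(2) — ⋯ —n— σ(n)`. -/
def stringTree {V : Type} {n : ℕ} (σ : Fin n ↪ V) : OrderedForest V n :=
  OrderedForest.ofNotReachable
    (fun i => s((Fin.cons z (fun j => some (σ j)) : Fin (n + 1) → Option V) i.castSucc,
      (Fin.cons z (fun j => some (σ j)) : Fin (n + 1) → Option V) i.succ)) <| by
    intro i x y hxy hr
    set f : Fin (n + 1) → Option V := Fin.cons z (fun j => some (σ j)) with hf
    have hinj : Function.Injective f := by
      rw [hf, Fin.cons_injective_iff]
      exact ⟨by simp, fun a b h => σ.injective (Option.some_injective _ h)⟩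
    have key : ∀ u v, (fromEdgeSet ((fun i : Fin n => s(f i.castSucc, f i.succ)) '' {i}ᶜ)).Reachable
        u v → ((∃ j, j ≤ i.castSucc ∧ f j = u) ↔ (∃ j, j ≤ i.castSucc ∧ f j = v)) := by
      rintro u v ⟨W⟩
      induction W with
      | nil => rfl
      | cons hadj _ ih =>
        refine Iff.trans ?_ ih
        rw [fromEdgeSet_adj] at hadj
        obtain ⟨⟨j, hj, hje⟩, -⟩ := hadj
        have hj' : (j : ℕ) ≠ i := fun hh => hj (Fin.ext hh)
        have e : ∀ m : Fin (n + 1), (∃ j, j ≤ i.castSucc ∧ f j = f m) ↔ m ≤ i.castSucc :=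
          fun m => ⟨fun ⟨j, h1, h2⟩ => hinj h2 ▸ h1, fun h => ⟨m, h, rfl⟩⟩
        have e' : j.castSucc ≤ i.castSucc ↔ j.succ ≤ i.castSucc := by
          simp only [Fin.le_def, Fin.val_castSucc, Fin.val_succ]; omega
        rcases Sym2.eq_iff.1 hje with ⟨rfl, rfl⟩ | ⟨rfl, rfl⟩
        · rw [e, e]; exact e'
        · rw [e, e]; exact e'.symm
    have e : ∀ m : Fin (n + 1), (∃ j, j ≤ i.castSucc ∧ f j = f m) ↔ m ≤ i.castSucc :=
      fun m => ⟨fun ⟨j, h1, h2⟩ => hinj h2 ▸ h1, fun h => ⟨m, h, rfl⟩⟩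
    have hk := key x y hr
    rcases Sym2.eq_iff.1 hxy with ⟨rfl, rfl⟩ | ⟨rfl, rfl⟩
    · rw [e, e] at hk
      simp [Fin.le_def] at hk
    · rw [e, e] at hk
      simp [Fin.le_def] at hk

/-- The monomial `f̃_J = f̃_{J(|k|)} ⋯ f̃_{J(2)} f̃_{J(1)}` in the free algebra on `f̃_1, …, f̃_r`. -/
def Multiindex.monomial {r : ℕ} {k : Fin r → ℕ} (J : Multiindex k) : FreeAlgebra ℂ (Fin r) :=
  ((List.ofFn J.1).reverse.map (FreeAlgebra.ι ℂ)).prod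

theorem Multiindex.linearIndependent_monomial {r : ℕ} (k : Fin r → ℕ) :
    LinearIndependent ℂ (fun J : Multiindex k => J.monomial) := by
  have h : (fun J : Multiindex k => J.monomial) = FreeAlgebra.basisFreeMonoid ℂ (Fin r) ∘
      (fun J : Multiindex k => FreeMonoid.ofList (List.ofFn J.1).reverse) := by
    funext J
    simp [Multiindex.monomial, FreeAlgebra.basisFreeMonoid, FreeAlgebra.equivMonoidAlgebraFreeMonoid]
  rw [h]
  refine (FreeAlgebra.basisFreeMonoid ℂ (Fin r)).linearIndependent.comp _ ?_
  intro J K hJK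
  apply Subtype.ext
  exact List.ofFn_injective (List.reverse_injective (FreeMonoid.ofList.injective hJK))

/-- `U[k]`: the component of multidegree `k` of the free algebra, spanned by the monomials in which
every `f̃_i` occurs exactly `k_i` times. -/
abbrev FreeComponent {r : ℕ} (k : Fin r → ℕ) : Submodule ℂ (FreeAlgebra ℂ (Fin r)) :=
  Submodule.span ℂ (Set.range fun J : Multiindex k => J.monomial)

/-- The basis of `U[k]` formed by the monomials `f̃_J`. -/
def monomialBasis {r : ℕ} (k : Fin r → ℕ) : Module.Basis (Multiindex k) ℂ (FreeComponent k) :=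
  Module.Basis.span (Multiindex.linearIndependent_monomial k)

/-! ### The pairing and the canonical element -/

/-- The bilinear pairing `U[k] × 𝒜(k) → ℂ` with
`⟨f̃_J, x⟩ = sgn(J) res_{t^{(J(|k|))}_{c(|k|)}} (⋯ res_{t^{(J(1))}_{c(1)}} (x))`. -/
def pairing {r : ℕ} (k : Fin r → ℕ) : FreeComponent k →ₗ[ℂ] SkewSpace k →ₗ[ℂ] ℂ :=
  (monomialBasis k).constr ℂ
    (fun J => J.sgn • (iteratedResidue (size k) J.vertices ∘ₗ (SkewSpace k).subtype))

open Classical in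
/-- For a perfect pairing of `U` and `A`, the basis of `A` dual to a finite basis of `U`. -/
def dualBasis {U A : Type} [AddCommGroup U] [Module ℂ U] [AddCommGroup A] [Module ℂ A]
    (B : U →ₗ[ℂ] A →ₗ[ℂ] ℂ) (hB : B.IsPerfPair) {ι : Type} [Finite ι]
    (b : Module.Basis ι ℂ U) : Module.Basis ι ℂ A :=
  b.dualBasis.map (B.flip.toPerfPair).symm

open Classical in
theorem apply_dualBasis {U A : Type} [AddCommGroup U] [Module ℂ U] [AddCommGroup A] [Module ℂ A]
    (B : U →ₗ[ℂ] A →ₗ[ℂ] ℂ) (hB : B.IsPerfPair) {ι : Type} [Finite ι]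
    (b : Module.Basis ι ℂ U) (i j : ι) :
    B (b i) (dualBasis B hB b j) = if i = j then 1 else 0 := by
  rw [dualBasis, Module.Basis.map_apply, LinearMap.apply_toPerfPair_flip,
    Module.Basis.dualBasis_apply_self]

/-- The canonical element `∑ b_i^* ⊗ b_i` of `A ⊗ U`, for a perfect pairing of `U` and `A`. -/
def canonicalElement {U A : Type} [AddCommGroup U] [Module ℂ U] [AddCommGroup A] [Module ℂ A]
    (B : U →ₗ[ℂ] A →ₗ[ℂ] ℂ) (hB : B.IsPerfPair) [Module.Finite ℂ U] : A ⊗[ℂ] U :=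
  ∑ i, dualBasis B hB (Module.finBasis ℂ U) i ⊗ₜ[ℂ] Module.finBasis ℂ U i

/-- The canonical element does not depend on the choice of the basis. -/
theorem canonicalElement_eq_sum {U A : Type} [AddCommGroup U] [Module ℂ U] [AddCommGroup A]
    [Module ℂ A] (B : U →ₗ[ℂ] A →ₗ[ℂ] ℂ) (hB : B.IsPerfPair) [Module.Finite ℂ U] {ι : Type}
    [Fintype ι] (b : Module.Basis ι ℂ U) :
    canonicalElement B hB = ∑ i, dualBasis B hB b i ⊗ₜ[ℂ] b i := by
  classical
  have hfun : ∀ {κ : Type} [Fintype κ] (b : Module.Basis κ ℂ U) (u : U),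
      u = ∑ i, B u (dualBasis B hB b i) • b i := by
    intro κ _ b u
    conv_lhs => rw [← b.sum_repr u]
    refine Finset.sum_congr rfl fun i _ => ?_
    congr 1
    rw [dualBasis, Module.Basis.map_apply, LinearMap.apply_toPerfPair_flip,
      Module.Basis.coe_dualBasis, Module.Basis.coord_apply]
  have hA : ∀ {κ : Type} [Fintype κ] (b : Module.Basis κ ℂ U) (x : A),
      x = ∑ i, B (b i) x • dualBasis B hB b i := by
    intro κ _ b x
    apply (LinearMap.IsPerfPair.bijective_right B).injective
    refine b.ext fun j => ?_
    simp [LinearMap.flip_apply, apply_dualBasis]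
  set c := Module.finBasis ℂ U
  calc canonicalElement B hB
      = ∑ i, dualBasis B hB c i ⊗ₜ[ℂ] ∑ j, B (c i) (dualBasis B hB b j) • b j := by
        rw [canonicalElement]
        exact Finset.sum_congr rfl fun i _ => by rw [← hfun b (c i)]
    _ = ∑ j, (∑ i, B (c i) (dualBasis B hB b j) • dualBasis B hB c i) ⊗ₜ[ℂ] b j := by
        simp only [TensorProduct.tmul_sum, TensorProduct.sum_tmul, TensorProduct.tmul_smul,
          TensorProduct.smul_tmul']
        exact Finset.sum_comm
    _ = _ := Finset.sum_congr rfl fun j _ => by rw [← hA c]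

instance {r : ℕ} (k : Fin r → ℕ) : Module.Finite ℂ (FreeComponent k) :=
  Module.Finite.of_basis (monomialBasis k)

/-- `Ω_k ∈ 𝒜(k) ⊗ U[k]`, for the duality given by the pairing. -/
def Omega {r : ℕ} (k : Fin r → ℕ) (h : (pairing k).IsPerfPair) :
    SkewSpace k ⊗[ℂ] FreeComponent k :=
  canonicalElement (pairing k) h

end

end StringTrees

open StringTrees

/-!
The string trees form a basis of `ForestSpace V n` for `n = |V|`, and the iterated residues along
enumerations of `V` are the dual basis; the theorem is the skew-symmetric part of this duality.

*Duality* (`iteratedResidue_stringTree`). A string tree is an iterated cone: `stringTree σ` arises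
from the string tree of the tail of `σ` by relabelling the root as `σ(1)` and joining it to a new
root by a new first edge. The residue at `t` undoes the cone with apex edge `zt`
(`OrderedForest.residue_cone`) and kills the cone with any other apex edge. Hence the iterated
residue along `τ` of the string tree of `σ` is `1` if `τ = σ` and `0` otherwise.

*Spanning* (`span_stringTree`). A forest with `|V|` edges on `V ∪ {z}` is a tree, so the root has
a neighbour. If two edges `zv`, `zw` meet at the root, the three-term relation expresses the forest
by the two forests in which one of these edges is replaced by `vw`
(`OrderedForest.cls_eq_slide_add_slide`), and both have fewer edges at the root. Once there is only
one edge at the root, the forest is up to sign a cone over a forest on one vertex less, and since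
the cone respects the relations, induction on `|V|` applies.

*Skew invariants.* Every enumeration of the symbols is obtained from that of a multiindex by an
element of `G_k` (`exists_vertices_trans_eq`), so a skew-invariant element whose residues along the
multiindices vanish is zero. The enumerations of different multiindices lie in different, free
orbits of `G_k`, so only `π = 1` contributes to the residue of an antisymmetrized string tree
(`pairing_asym_stringTree`). Therefore the elements `sgn(J) asym(…)` pair with the monomials as a
dual basis does, which gives injectivity of the pairing on the other side as well.
-/

namespace StringTrees

open SimpleGraph

noncomputable section

variable {V : Type} {p : ℕ}

/-! ### Cones over forests -/

/-- The inclusion of the vertex set `V ∖ {t} ∪ {z}` in `V ∪ {z}` that sends `z` to `t`. -/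
def attachVertex (t : V) (x : Option {x : V // x ≠ t}) : Option V :=
  some (x.elim t Subtype.val)

theorem contractVertex_attachVertex (t : V) (x : Option {x : V // x ≠ t}) :
    contractVertex t (attachVertex t x) = x := by
  cases x with
  | none => simp [attachVertex, contractVertex]
  | some x => simp [attachVertex, contractVertex, x.2]

theorem attachVertex_contractVertex {t : V} {x : Option V} (hx : x ≠ z) :
    attachVertex t (contractVertex t x) = x := by
  cases x with
  | none => exact absurd rfl hx
  | some x =>
    by_cases h : x = t
    · simp [attachVertex, contractVertex, h]
    · simp [attachVertex, contractVertex, h]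

theorem map_contractVertex_map_attachVertex (t : V) (e : Sym2 (Option {x : V // x ≠ t})) :
    Sym2.map (contractVertex t) (Sym2.map (attachVertex t) e) = e := by
  induction e with | _ x y => simp [Sym2.map_mk, contractVertex_attachVertex]

theorem z_notMem_map_attachVertex (t : V) (e : Sym2 (Option {x : V // x ≠ t})) :
    z ∉ Sym2.map (attachVertex t) e := by
  simp [Sym2.mem_map, attachVertex]

theorem map_attachVertex_map_contractVertex {t : V} {e : Sym2 (Option V)} (he : z ∉ e) :
    Sym2.map (attachVertex t) (Sym2.map (contractVertex t) e) = e := by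
  induction e with
  | _ x y =>
    rw [Sym2.mem_iff, not_or] at he
    rw [Sym2.map_mk, Sym2.map_mk, attachVertex_contractVertex (Ne.symm he.1),
      attachVertex_contractVertex (Ne.symm he.2)]

theorem reachable_iff_eq_of_forall_notMem {W : Type} {S : Set (Sym2 W)} {x y : W}
    (h : ∀ e ∈ S, x ∉ e) : (fromEdgeSet S).Reachable x y ↔ x = y := by
  refine ⟨?_, fun h => h ▸ Reachable.rfl⟩
  rintro ⟨w⟩
  cases w with
  | nil => rfl
  | cons hadj _ =>
    rw [fromEdgeSet_adj] at hadj
    exact absurd (Sym2.mem_mk_left _ _) (h _ hadj.1)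

/-- The edges of the cone: the edges of `T` with `z` replaced by `t`, preceded by the edge `zt`. -/
def coneEdge (t : V) (e : Fin p → Sym2 (Option {x : V // x ≠ t})) : Fin (p + 1) → Sym2 (Option V) :=
  Fin.cons s(z, some t) fun i => Sym2.map (attachVertex t) (e i)

@[simp]
theorem coneEdge_zero (t : V) (e : Fin p → Sym2 (Option {x : V // x ≠ t})) :
    coneEdge t e 0 = s(z, some t) := rfl

@[simp]
theorem coneEdge_succ (t : V) (e : Fin p → Sym2 (Option {x : V // x ≠ t})) (i : Fin p) :
    coneEdge t e i.succ = Sym2.map (attachVertex t) (e i) := rfl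

/-- The cone over an ordered forest on `V ∖ {t} ∪ {z}`: its root is relabelled `t` and joined to a
new root `z` by an edge, which comes first in the numbering. -/
def OrderedForest.cone (t : V) (T : OrderedForest {x : V // x ≠ t} p) : OrderedForest V (p + 1) :=
  OrderedForest.ofNotReachable (coneEdge t T.edge) <| by
    intro i
    induction i using Fin.cases with
    | zero =>
      intro x y hxy
      have h0 : ¬ (fromEdgeSet (coneEdge t T.edge '' {0}ᶜ)).Reachable z (some t) := by
        rw [reachable_iff_eq_of_forall_notMem]
        · simp
        · rintro _ ⟨j, hj, rfl⟩
          obtain ⟨j, rfl⟩ := Fin.exists_succ_eq.2 hj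
          exact z_notMem_map_attachVertex t _
      rcases Sym2.eq_iff.1 hxy with ⟨rfl, rfl⟩ | ⟨rfl, rfl⟩
      · exact h0
      · exact fun h => h0 h.symm
    | succ i =>
      intro x y hxy hr
      -- Contracting `zt` maps the complement of an edge of the cone to its complement in `T`.
      have key : ∀ u v, (fromEdgeSet (coneEdge t T.edge '' {i.succ}ᶜ)).Reachable u v →
          (fromEdgeSet (T.edge '' {i}ᶜ)).Reachable (contractVertex t u) (contractVertex t v) := by
        rintro u v ⟨w⟩
        induction w with
        | nil => rfl
        | @cons u v _ hadj _ ih =>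
          refine Reachable.trans ?_ ih
          rw [fromEdgeSet_adj] at hadj
          obtain ⟨⟨j, hj, hje⟩, -⟩ := hadj
          have hm := congrArg (Sym2.map (contractVertex t)) hje
          induction j using Fin.cases with
          | zero =>
            have : contractVertex t u = contractVertex t v := by
              rcases Sym2.eq_iff.1 hje with ⟨rfl, rfl⟩ | ⟨rfl, rfl⟩ <;> simp [contractVertex]
            rw [this]
          | succ j =>
            rw [coneEdge_succ, map_contractVertex_map_attachVertex, Sym2.map_mk] at hm
            by_cases hd : contractVertex t u = contractVertex t v
            · rw [hd]
            · refine Adj.reachable ?_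
              rw [fromEdgeSet_adj]
              exact ⟨⟨j, fun h => hj (congrArg Fin.succ h), hm⟩, hd⟩
      refine T.not_reachable (i := i) ?_ (key x y hr)
      rw [← Sym2.map_mk, ← hxy, coneEdge_succ, map_contractVertex_map_attachVertex]

@[simp]
theorem OrderedForest.cone_edge (t : V) (T : OrderedForest {x : V // x ≠ t} p) :
    (T.cone t).edge = coneEdge t T.edge := rfl

theorem OrderedForest.residue_cone (t : V) (T : OrderedForest {x : V // x ≠ t} p) :
    (T.cone t).residue t = T.cls := by
  rw [residue_of_edge (a := 0) rfl, Fin.val_zero, pow_zero, one_smul]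
  congr 1
  ext1
  funext i
  exact map_contractVertex_map_attachVertex t _

theorem OrderedForest.residue_cone_of_ne {s t : V} (h : s ≠ t)
    (T : OrderedForest {x : V // x ≠ t} p) : (T.cone t).residue s = 0 := by
  refine residue_of_not fun a ha => ?_
  induction a using Fin.cases with
  | zero => exact h (by simpa using ha.symm)
  | succ a => exact z_notMem_map_attachVertex t (T.edge a) (by
      rw [← coneEdge_succ, ← cone_edge, ha]; exact Sym2.mem_mk_left _ _)

/-- A forest in which the first edge `zt` is the only edge at the root is a cone. -/
theorem OrderedForest.cone_contract {t : V} {T : OrderedForest V (p + 1)}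
    (h0 : T.edge 0 = s(z, some t)) (h : ∀ i : Fin p, z ∉ T.edge i.succ) :
    (T.contract t 0 h0).cone t = T := by
  ext1
  funext i
  induction i using Fin.cases with
  | zero => exact h0.symm
  | succ i => exact map_attachVertex_map_contractVertex (h i)

/-- The cone as a linear map of forest spaces. -/
def ForestSpace.cone (t : V) : ForestSpace {x : V // x ≠ t} p →ₗ[ℂ] ForestSpace V (p + 1) :=
  ForestSpace.lift (fun T => (T.cone t).cls)
    (fun T₁ T₂ a b hab h => OrderedForest.cls_add_cls (a := a.succ) (b := b.succ)
      (fun hh => hab (Fin.succ_injective _ hh)) <| by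
        funext i
        induction i using Fin.cases with
        | zero =>
          rw [Function.comp_apply, Equiv.swap_apply_of_ne_of_ne (Fin.succ_ne_zero a).symm
            (Fin.succ_ne_zero b).symm]
          rfl
        | succ i =>
          rw [Function.comp_apply, ← (Fin.succ_injective p).map_swap, OrderedForest.cone_edge,
            OrderedForest.cone_edge, coneEdge_succ, coneEdge_succ, h, Function.comp_apply])
    (fun T₁ T₂ T₃ a b u v w hab h₁ h₂ h₃ h =>
      OrderedForest.cls_add_cls_add_cls (a := a.succ) (b := b.succ) (u := attachVertex t u)
      (v := attachVertex t v) (w := attachVertex t w) (fun hh => hab (Fin.succ_injective _ hh))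
      ⟨congrArg (Sym2.map (attachVertex t)) h₁.1, congrArg (Sym2.map (attachVertex t)) h₁.2⟩
      ⟨congrArg (Sym2.map (attachVertex t)) h₂.1, congrArg (Sym2.map (attachVertex t)) h₂.2⟩
      ⟨congrArg (Sym2.map (attachVertex t)) h₃.1, congrArg (Sym2.map (attachVertex t)) h₃.2⟩ <| by
        intro c hca hcb
        induction c using Fin.cases with
        | zero => exact ⟨rfl, rfl⟩
        | succ c =>
          obtain ⟨e₂, e₃⟩ := h c (fun hh => hca (congrArg Fin.succ hh))
            (fun hh => hcb (congrArg Fin.succ hh))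
          exact ⟨congrArg (Sym2.map (attachVertex t)) e₂, congrArg (Sym2.map (attachVertex t)) e₃⟩)

@[simp]
theorem ForestSpace.cone_cls (t : V) (T : OrderedForest {x : V // x ≠ t} p) :
    ForestSpace.cone t T.cls = (T.cone t).cls :=
  ForestSpace.lift_cls _ _ _ T

/-! ### String trees and iterated residues -/

/-- The sequence `σ(2), …, σ(n + 1)` in `V ∖ {σ(1)}`. -/
def tailEmbedding {n : ℕ} (σ : Fin (n + 1) ↪ V) : Fin n ↪ {x : V // x ≠ σ 0} :=
  ⟨fun i => ⟨σ i.succ, fun h => Fin.succ_ne_zero i (σ.injective h)⟩,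
    fun _ _ h => Fin.succ_injective _ (σ.injective (congrArg Subtype.val h))⟩

/-- The sequence `t, σ(1), …, σ(n)`, for a sequence `σ` in `V ∖ {t}`. -/
def consEmbedding {n : ℕ} (t : V) (σ : Fin n ↪ {x : V // x ≠ t}) : Fin (n + 1) ↪ V :=
  ⟨Fin.cons t fun i => (σ i : V), Fin.cons_injective_iff.2
    ⟨by rintro ⟨i, hi⟩; exact (σ i).2 hi, Subtype.val_injective.comp σ.injective⟩⟩

theorem cone_stringTree_tail {n : ℕ} (σ : Fin (n + 1) ↪ V) :
    (stringTree (tailEmbedding σ)).cone (σ 0) = stringTree σ := by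
  ext1
  funext i
  induction i using Fin.cases with
  | zero => rfl
  | succ i =>
    change Sym2.map (attachVertex (σ 0)) s(_, _) = s(_, _)
    rw [Sym2.map_mk]
    congr 2
    cases n with
    | zero => exact i.elim0
    | succ n => cases i using Fin.cases <;> rfl

theorem cone_stringTree {n : ℕ} (t : V) (σ : Fin n ↪ {x : V // x ≠ t}) :
    (stringTree σ).cone t = stringTree (consEmbedding t σ) :=
  cone_stringTree_tail (consEmbedding t σ)

theorem iteratedResidue_succ {n : ℕ} (τ : Fin (n + 1) ↪ V) (x : ForestSpace V (n + 1)) :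
    iteratedResidue (n + 1) τ x =
      iteratedResidue n (tailEmbedding τ) (ForestSpace.residue (τ 0) x) := rfl

open Classical in
/-- The string trees and the iterated residues are dual to each other. -/
theorem iteratedResidue_stringTree {n : ℕ} {V : Type} (τ σ : Fin n ↪ V) :
    iteratedResidue n τ (stringTree σ).cls = if τ = σ then 1 else 0 := by
  induction n generalizing V with
  | zero =>
    rw [if_pos (Subsingleton.elim _ _)]
    simp [iteratedResidue, ForestSpace.constant]
  | succ n ih =>
    rw [iteratedResidue_succ, ForestSpace.residue, ForestSpace.lift_cls, ← cone_stringTree_tail σ]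
    by_cases h0 : τ 0 = σ 0
    -- Writing `σ` as `τ 0` followed by `σ'` puts both tails over the same type `V ∖ {τ 0}`.
    · obtain ⟨σ', rfl⟩ : ∃ σ', σ = consEmbedding (τ 0) σ' := by
        have : ∀ t, t = σ 0 → ∃ σ', σ = consEmbedding t σ' := by
          rintro _ rfl
          refine ⟨tailEmbedding σ, DFunLike.ext _ _ fun i => ?_⟩
          cases i using Fin.cases <;> rfl
        exact this _ h0
      change iteratedResidue n (tailEmbedding τ) (((stringTree σ').cone (τ 0)).residue (τ 0)) = _
      rw [OrderedForest.residue_cone, ih]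
      congr 1
      rw [eq_iff_iff]
      constructor
      · rintro rfl
        refine DFunLike.ext _ _ fun i => ?_
        cases i using Fin.cases <;> rfl
      · intro h
        refine DFunLike.ext _ _ fun i => Subtype.ext ?_
        exact DFunLike.congr_fun h i.succ
    · rw [OrderedForest.residue_cone_of_ne h0, map_zero, if_neg]
      rintro rfl
      exact h0 rfl

/-! ### String trees span the forest space -/

/-- Renumbering of the edges. -/
def OrderedForest.reindex (T : OrderedForest V p) (π : Equiv.Perm (Fin p)) :
    OrderedForest V p where
  edge := T.edge ∘ π
  injective := T.injective.comp π.injective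
  not_isDiag _ := T.not_isDiag _
  acyclic := by rw [π.surjective.range_comp]; exact T.acyclic

/-- The far ends of two edges `uv` and `uw` are not joined by a path that avoids `uw`. -/
theorem OrderedForest.not_reachable_of_adjacent (T : OrderedForest V p) {a b : Fin p}
    {u v w : Option V} (hab : a ≠ b) (ha : T.edge a = s(u, v)) (hb : T.edge b = s(u, w)) :
    ¬ (fromEdgeSet (T.edge '' {b}ᶜ)).Reachable v w := by
  refine fun h => T.not_reachable hb (Reachable.trans (Adj.reachable ?_) h)
  rw [fromEdgeSet_adj]
  exact ⟨⟨a, hab, ha⟩, fun h => T.not_isDiag a (by rw [ha, h]; simp)⟩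

/-- If `uv` and `uw` are the edges `a` and `b` of a forest, the edge `uw` may be replaced
by `vw`. -/
def OrderedForest.slide (T : OrderedForest V p) {a b : Fin p} {u v w : Option V} (hab : a ≠ b)
    (ha : T.edge a = s(u, v)) (hb : T.edge b = s(u, w)) : OrderedForest V p where
  edge := Function.update T.edge b s(v, w)
  injective := by
    have hnr := OrderedForest.not_reachable_of_adjacent T hab ha hb
    have hvw : v ≠ w := fun h => hnr (h ▸ Reachable.rfl)
    have hc : ∀ c, c ≠ b → T.edge c ≠ s(v, w) := fun c hcb h => hnr <| Adj.reachable <| by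
      rw [fromEdgeSet_adj]
      exact ⟨⟨c, hcb, h⟩, hvw⟩
    intro c d hcd
    by_cases hcb : c = b <;> by_cases hdb : d = b
    · rw [hcb, hdb]
    · subst hcb
      rw [Function.update_self, Function.update_of_ne hdb] at hcd
      exact absurd hcd.symm (hc d hdb)
    · subst hdb
      rw [Function.update_self, Function.update_of_ne hcb] at hcd
      exact absurd hcd (hc c hcb)
    · rw [Function.update_of_ne hcb, Function.update_of_ne hdb] at hcd
      exact T.injective hcd
  not_isDiag c := by
    have hnr := OrderedForest.not_reachable_of_adjacent T hab ha hb
    by_cases hcb : c = b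
    · subst hcb
      rw [Function.update_self, Sym2.mk_isDiag_iff]
      exact fun h => hnr (h ▸ Reachable.rfl)
    · rw [Function.update_of_ne hcb]
      exact T.not_isDiag c
  acyclic := by
    have hac : (fromEdgeSet (T.edge '' {b}ᶜ)).IsAcyclic :=
      T.acyclic.anti (fromEdgeSet_mono (Set.image_subset_range _ _))
    refine (hac.sup_edge_of_not_reachable
      (OrderedForest.not_reachable_of_adjacent T hab ha hb)).anti ?_
    rw [SimpleGraph.edge, ← fromEdgeSet_union]
    refine fromEdgeSet_mono ?_
    rintro _ ⟨c, rfl⟩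
    by_cases hcb : c = b
    · right; rw [hcb, Function.update_self]; rfl
    · left; rw [Function.update_of_ne hcb]; exact ⟨c, hcb, rfl⟩

/-- The second relation, solved for the forest in which the two edges meet at `u`. -/
theorem OrderedForest.cls_eq_slide_add_slide (T : OrderedForest V p) {a b : Fin p}
    {u v w : Option V} (hab : a ≠ b) (ha : T.edge a = s(u, v)) (hb : T.edge b = s(u, w)) :
    T.cls = (T.slide hab ha hb).cls + (T.slide hab.symm hb ha).cls := by
  have ea : (T.slide hab ha hb).edge a = s(u, v) := (Function.update_of_ne hab _ _).trans ha
  have eb : (T.slide hab ha hb).edge b = s(v, w) := Function.update_self _ _ _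
  have ea' : (T.slide hab.symm hb ha).edge a = s(w, v) := Function.update_self _ _ _
  have eb' : (T.slide hab.symm hb ha).edge b = s(u, w) :=
    (Function.update_of_ne hab.symm _ _).trans hb
  have h₁ := cls_add_cls (T₁ := (T.slide hab ha hb).reindex (Equiv.swap a b))
    (T₂ := T.slide hab ha hb) hab rfl
  have h₂ := cls_add_cls (T₁ := (T.slide hab.symm hb ha).reindex (Equiv.swap a b))
    (T₂ := T.slide hab.symm hb ha) hab rfl
  have h₃ := cls_add_cls_add_cls (T₁ := T) (T₂ := (T.slide hab ha hb).reindex (Equiv.swap a b))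
    (T₃ := (T.slide hab.symm hb ha).reindex (Equiv.swap a b)) hab ⟨ha, hb⟩
    (by simp [reindex, ea, eb]) (by simp [reindex, ea', eb', Sym2.eq_swap]) (by
      intro c hca hcb
      simp only [reindex, Function.comp_apply, Equiv.swap_apply_of_ne_of_ne hca hcb]
      exact ⟨Function.update_of_ne hcb _ _, Function.update_of_ne hca _ _⟩)
  rw [eq_neg_of_add_eq_zero_left h₁, eq_neg_of_add_eq_zero_left h₂, ← sub_eq_add_neg,
    ← sub_eq_add_neg, sub_sub, sub_eq_zero] at h₃
  exact h₃

open Classical in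
/-- The number of edges at the root `z`. -/
def OrderedForest.rootDegree (T : OrderedForest V p) : ℕ :=
  (Finset.univ.filter fun i => z ∈ T.edge i).card

theorem OrderedForest.rootDegree_slide_lt (T : OrderedForest V p) {a b : Fin p}
    {v w : Option V} (hab : a ≠ b) (ha : T.edge a = s(z, v)) (hb : T.edge b = s(z, w)) :
    (T.slide hab ha hb).rootDegree < T.rootDegree := by
  classical
  have hv : z ≠ v := fun h => T.not_isDiag a (by rw [ha, ← h]; simp)
  have hw : z ≠ w := fun h => T.not_isDiag b (by rw [hb, ← h]; simp)
  have eb : (T.slide hab ha hb).edge b = s(v, w) := Function.update_self _ _ _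
  refine Finset.card_lt_card (Finset.ssubset_iff_of_subset ?_ |>.2 ⟨b, ?_, ?_⟩)
  · intro c hc
    simp only [Finset.mem_filter, Finset.mem_univ, true_and] at hc ⊢
    by_cases hcb : c = b
    · rw [hcb, hb]; exact Sym2.mem_mk_left _ _
    · rwa [show (T.slide hab ha hb).edge c = T.edge c from Function.update_of_ne hcb _ _] at hc
  · simp [hb]
  · simp [eb, hv, hw]

/-- A forest with as many edges as there are vertices besides the root is connected, so it has an
edge at the root. -/
theorem OrderedForest.exists_edge_eq [Finite V] (T : OrderedForest V (p + 1))
    (hV : Nat.card V = p + 1) : ∃ a t, T.edge a = s(z, some t) := by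
  classical
  set G := fromEdgeSet (Set.range T.edge) with hG
  -- A spanning tree containing the forest has as many edges, so it is the forest.
  obtain ⟨F, hGF, -, hF⟩ :=
    (connected_top (V := Option V)).exists_isTree_le_of_le_of_isAcyclic le_top T.acyclic
  have hcard := (isTree_iff_connected_and_card.1 hF).2
  rw [Finite.card_option, hV, add_left_inj] at hcard
  have hGe : G.edgeSet = Set.range T.edge := by
    rw [hG, edgeSet_fromEdgeSet, sdiff_eq_left, Set.disjoint_left]
    rintro _ ⟨i, rfl⟩ hi
    exact T.not_isDiag i hi
  have hGc : Nat.card G.edgeSet = p + 1 := by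
    rw [hGe, Nat.card_range_of_injective T.injective, Nat.card_fin]
  have hEq : G.edgeSet = F.edgeSet := by
    refine Set.eq_of_subset_of_ncard_le (edgeSet_mono hGF) ?_ (Set.toFinite _)
    rw [← Nat.card_coe_set_eq, ← Nat.card_coe_set_eq, hcard, hGc]
  have : Nonempty V := (Nat.card_pos_iff.1 (by omega)).1
  have : Nontrivial (Option V) := Option.nontrivial
  obtain ⟨x, hx⟩ := hF.connected.preconnected.exists_adj_of_nontrivial (none : Option V)
  have hx' : s(none, x) ∈ G.edgeSet := hEq ▸ hx
  rw [hGe] at hx'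
  obtain ⟨a, ha⟩ := hx'
  cases x with
  | none => exact absurd rfl hx.ne
  | some t => exact ⟨a, t, ha⟩

/-- The span of the string trees contains every forest with one edge at the root, if this holds
for all forests on one vertex less. -/
theorem OrderedForest.cls_mem_span_of_unique (T : OrderedForest V (p + 1))
    {a : Fin (p + 1)} {t : V} (ha : T.edge a = s(z, some t)) (h : ∀ b, b ≠ a → z ∉ T.edge b)
    (ih : ∀ S : OrderedForest {x : V // x ≠ t} p,
      S.cls ∈ Submodule.span ℂ (Set.range fun σ : Fin p ↪ {x : V // x ≠ t} => (stringTree σ).cls)) :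
    T.cls ∈ Submodule.span ℂ (Set.range fun σ : Fin (p + 1) ↪ V => (stringTree σ).cls) := by
  -- Up to sign, `zt` is the first edge, and then `T` is the cone over its contraction.
  set π : Equiv.Perm (Fin (p + 1)) := Equiv.swap 0 a
  have h0 : (T.reindex π).edge 0 = s(z, some t) := by
    simpa [reindex, π] using ha
  have hne : ∀ i : Fin p, z ∉ (T.reindex π).edge i.succ := fun i => h _ fun hi =>
    Fin.succ_ne_zero i (π.injective (hi.trans (Equiv.swap_apply_left _ _).symm))
  have hT := cls_perm π⁻¹ T (T.reindex π) (by funext i; simp [reindex])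
  rw [hT]
  refine Submodule.smul_mem _ _ ?_
  rw [← cone_contract h0 hne, ← ForestSpace.cone_cls]
  have hm := Submodule.mem_map_of_mem (f := ForestSpace.cone t) (ih ((T.reindex π).contract t 0 h0))
  refine Submodule.map_span_le _ _ _ |>.2 ?_ hm
  rintro _ ⟨σ, rfl⟩
  rw [ForestSpace.cone_cls, cone_stringTree]
  exact Submodule.subset_span ⟨_, rfl⟩

/-- Induction on the number of vertices and, within it, on the number of edges at the root. -/
theorem OrderedForest.cls_mem_span_stringTree [Finite V] (hV : Nat.card V = p)
    (T : OrderedForest V p) :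
    T.cls ∈ Submodule.span ℂ (Set.range fun σ : Fin p ↪ V => (stringTree σ).cls) := by
  induction p generalizing V with
  | zero =>
    refine Submodule.subset_span ⟨⟨Fin.elim0, fun i => i.elim0⟩, congrArg _ ?_⟩
    ext1
    exact Subsingleton.elim _ _
  | succ p ih =>
    induction hd : T.rootDegree using Nat.strong_induction_on generalizing T with
    | _ d ihd =>
      subst hd
      obtain ⟨a, t, ha⟩ := T.exists_edge_eq hV
      by_cases hu : ∀ b, b ≠ a → z ∉ T.edge b
      · refine T.cls_mem_span_of_unique ha hu fun S => ih ?_ S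
        classical
        have := Fintype.ofFinite V
        rw [Nat.card_eq_fintype_card] at hV
        rw [Nat.card_eq_fintype_card, Fintype.card_subtype_compl, Fintype.card_subtype_eq, hV,
          Nat.add_sub_cancel]
      · push Not at hu
        obtain ⟨b, hba, w, hb⟩ := hu
        rw [T.cls_eq_slide_add_slide hba.symm ha hb]
        exact Submodule.add_mem _ (ihd _ (T.rootDegree_slide_lt _ _ _) _ rfl)
          (ihd _ (T.rootDegree_slide_lt _ _ _) _ rfl)

theorem span_stringTree [Finite V] (hV : Nat.card V = p) :
    Submodule.span ℂ (Set.range fun σ : Fin p ↪ V => (stringTree σ).cls) = ⊤ := by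
  rw [eq_top_iff]
  rintro x -
  obtain ⟨x, rfl⟩ := Submodule.Quotient.mk_surjective _ x
  induction x using Finsupp.induction_linear with
  | zero => exact Submodule.zero_mem _
  | add x y hx hy => exact Submodule.add_mem _ hx hy
  | single T c =>
    have : (Submodule.Quotient.mk (Finsupp.single T c) : ForestSpace V p) = c • T.cls := by
      rw [OrderedForest.cls, ← Submodule.Quotient.mk_smul, Finsupp.smul_single_one]
    rw [this]
    exact Submodule.smul_mem _ _ (T.cls_mem_span_stringTree hV)

/-- An element of top degree is determined by its iterated residues. -/
theorem eq_zero_of_iteratedResidue [Finite V] (hV : Nat.card V = p) (x : ForestSpace V p)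
    (h : ∀ σ : Fin p ↪ V, iteratedResidue p σ x = 0) : x = 0 := by
  classical
  have hx : x ∈ Submodule.span ℂ (Set.range fun σ : Fin p ↪ V => (stringTree σ).cls) := by
    rw [span_stringTree hV]; trivial
  have := Fintype.ofFinite (Fin p ↪ V)
  obtain ⟨c, rfl⟩ := (Submodule.mem_span_range_iff_exists_fun ℂ).1 hx
  refine Finset.sum_eq_zero fun σ _ => ?_
  have := h σ
  simp only [map_sum, map_smul, iteratedResidue_stringTree, smul_eq_mul, mul_ite, mul_one,
    mul_zero, Finset.sum_ite_eq, Finset.mem_univ, if_true] at this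
  rw [this, zero_smul]

/-! ### Relabelling the vertices -/

theorem act_stringTree {n : ℕ} (π : Equiv.Perm V) (σ : Fin n ↪ V) :
    ForestSpace.act π (stringTree σ).cls = (stringTree (σ.trans π.toEmbedding)).cls := by
  rw [ForestSpace.act, ForestSpace.lift_cls]
  congr 1
  ext1
  funext i
  change Sym2.map (Option.map π) s(_, _) = s(_, _)
  rw [Sym2.map_mk]
  have h : ∀ j : Fin (n + 1),
      Option.map π ((Fin.cons z (fun j => some (σ j)) : Fin (n + 1) → Option V) j) =
        (Fin.cons z (fun j => some (π (σ j))) : Fin (n + 1) → Option V) j := by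
    intro j
    cases j using Fin.cases <;> rfl
  rw [h, h]
  rfl

/-- Iterated residues are equivariant; it suffices to check this on string trees. -/
theorem iteratedResidue_act [Finite V] (hV : Nat.card V = p) (π : Equiv.Perm V)
    (σ : Fin p ↪ V) (x : ForestSpace V p) :
    iteratedResidue p (σ.trans π.toEmbedding) (ForestSpace.act π x) = iteratedResidue p σ x := by
  classical
  suffices h : iteratedResidue p (σ.trans π.toEmbedding) ∘ₗ ForestSpace.act π =
      iteratedResidue p σ from LinearMap.congr_fun h x
  refine LinearMap.ext_on_range (span_stringTree hV) fun τ => ?_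
  rw [LinearMap.comp_apply, act_stringTree, iteratedResidue_stringTree, iteratedResidue_stringTree]
  congr 1
  rw [eq_iff_iff]
  refine ⟨fun h => ?_, fun h => h ▸ rfl⟩
  exact DFunLike.ext _ _ fun i => π.injective (DFunLike.congr_fun h i)

variable {r : ℕ} {k : Fin r → ℕ}

/-! ### Multiindices -/

theorem natCard_symbols (k : Fin r → ℕ) : Nat.card (Symbols k) = size k := by
  simp [Nat.card_eq_fintype_card]

theorem Multiindex.sgn_mul_self (J : Multiindex k) : J.sgn * J.sgn = 1 := by
  rw [Multiindex.sgn, ← mul_pow]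
  simp

theorem bijective_of_embedding_symbols (σ : Fin (size k) ↪ Symbols k) : Function.Bijective σ :=
  (Fintype.bijective_iff_injective_and_card σ).2 ⟨σ.injective, by simp⟩

/-- The multiindex of upper indices of an enumeration of the symbols. -/
def multiindexOf (σ : Fin (size k) ↪ Symbols k) : Multiindex k :=
  ⟨fun a => (σ a).1, fun i => by
    have h : Finset.univ.filter (fun a => (σ a).1 = i) =
        (Finset.univ.map (Function.Embedding.sigmaMk i)).map
          (Equiv.ofBijective σ (bijective_of_embedding_symbols σ)).symm.toEmbedding := by
      ext a
      simp only [Finset.mem_filter, Finset.mem_univ, true_and, Finset.mem_map,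
        Function.Embedding.sigmaMk_apply, exists_exists_eq_and, Equiv.coe_toEmbedding,
        Equiv.symm_apply_eq, Equiv.ofBijective_apply]
      constructor
      · rintro rfl
        exact ⟨(σ a).2, rfl⟩
      · rintro ⟨j, hj⟩
        rw [← hj]
    rw [h]
    simp⟩

/-- A permutation of the symbols which preserves the upper indices comes from `G_k`. -/
theorem exists_sigmaCongrRight_eq (e : Equiv.Perm (Symbols k)) (he : ∀ s, (e s).1 = s.1) :
    ∃ π : SymGroup k, Equiv.Perm.sigmaCongrRight π = e := by
  have h : ∀ i (j : Fin (k i)), ∃ j' : Fin (k i), e ⟨i, j⟩ = ⟨i, j'⟩ := by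
    intro i j
    have hi := he ⟨i, j⟩
    revert hi
    generalize e ⟨i, j⟩ = s
    obtain ⟨i', j'⟩ := s
    rintro rfl
    exact ⟨j', rfl⟩
  choose f hf using h
  have hinj : ∀ i, Function.Injective (f i) := by
    intro i j j' hj
    have := e.injective ((hf i j).trans ((congrArg _ hj).trans (hf i j').symm))
    simpa using this
  refine ⟨fun i => Equiv.ofBijective (f i) (Finite.injective_iff_bijective.1 (hinj i)), ?_⟩
  ext1 ⟨i, j⟩
  exact (hf i j).symm

/-- Every enumeration of the symbols is obtained from that of a multiindex by an element
of `G_k`. -/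
theorem exists_vertices_trans_eq (σ : Fin (size k) ↪ Symbols k) :
    ∃ (J : Multiindex k) (π : SymGroup k),
      J.vertices.trans (Equiv.Perm.sigmaCongrRight π).toEmbedding = σ := by
  set J := multiindexOf σ
  set e := (Equiv.ofBijective _ (bijective_of_embedding_symbols J.vertices)).symm.trans
    (Equiv.ofBijective _ (bijective_of_embedding_symbols σ))
  have hJ : ∀ a, e (J.vertices a) = σ a := by
    intro a
    have : (Equiv.ofBijective _ (bijective_of_embedding_symbols J.vertices)).symm (J.vertices a)
        = a := Equiv.ofBijective_symm_apply_apply _ _ a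
    simp [e, this]
  obtain ⟨π, hπ⟩ := exists_sigmaCongrRight_eq e fun s => by
    obtain ⟨a, rfl⟩ := (bijective_of_embedding_symbols J.vertices).2 s
    rw [hJ]
    rfl
  refine ⟨J, π, DFunLike.ext _ _ fun a => ?_⟩
  change Equiv.Perm.sigmaCongrRight π (J.vertices a) = σ a
  rw [hπ, hJ]

/-- An element of `G_k` preserves upper indices, and a multiindex is determined by the upper indices
of its symbols. -/
theorem vertices_trans_eq_iff (J K : Multiindex k) (π : SymGroup k) :
    K.vertices = J.vertices.trans (Equiv.Perm.sigmaCongrRight π).toEmbedding ↔ K = J ∧ π = 1 := by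
  constructor
  · intro h
    obtain rfl : K = J := Subtype.ext <| funext fun a =>
      congrArg Sigma.fst (DFunLike.congr_fun h a)
    refine ⟨rfl, funext fun i => Equiv.ext fun j => ?_⟩
    obtain ⟨a, ha⟩ := (bijective_of_embedding_symbols K.vertices).2 ⟨i, j⟩
    have h' : K.vertices a = Equiv.Perm.sigmaCongrRight π (K.vertices a) := DFunLike.congr_fun h a
    rw [ha] at h'
    simpa using h'.symm
  · rintro ⟨rfl, rfl⟩
    rfl

/-! ### The pairing -/

theorem pairing_monomialBasis (J : Multiindex k) (x : SkewSpace k) :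
    pairing k (monomialBasis k J) x =
      J.sgn * iteratedResidue (size k) J.vertices (x : ForestSpace (Symbols k) (size k)) := by
  rw [pairing, Module.Basis.constr_basis]
  rfl

theorem permSign_one : permSign (1 : SymGroup k) = 1 := by simp [permSign]

open Classical in
/-- The only summand of the antisymmetrization that contributes is that of `π = 1`. -/
theorem pairing_asym_stringTree (J K : Multiindex k) :
    pairing k (monomialBasis k K) (J.sgn • asym (stringTree J.vertices).cls) =
      if K = J then 1 else 0 := by
  have h : iteratedResidue (size k) K.vertices
      (asym (stringTree J.vertices).cls : SkewSpace k).1 = if K = J then 1 else 0 := by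
    simp only [asym, map_sum, map_smul, groupAct, act_stringTree, iteratedResidue_stringTree,
      vertices_trans_eq_iff]
    by_cases hKJ : K = J
    · simp [hKJ, permSign_one]
    · simp [hKJ]
  rw [map_smul, pairing_monomialBasis, h, smul_eq_mul]
  split_ifs with hKJ
  · rw [hKJ, mul_one, J.sgn_mul_self]
  · simp

/-- Pairing with the candidates for the dual basis reads off the coordinates. -/
theorem pairing_injective (k : Fin r → ℕ) : Function.Injective (pairing k) := by
  classical
  rw [← LinearMap.ker_eq_bot, LinearMap.ker_eq_bot']
  intro u hu
  refine (monomialBasis k).ext_elem fun J => ?_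
  have h : (pairing k).flip (J.sgn • asym (stringTree J.vertices).cls) =
      (monomialBasis k).coord J := by
    refine (monomialBasis k).ext fun K => ?_
    rw [LinearMap.flip_apply, pairing_asym_stringTree, Module.Basis.coord_apply,
      Module.Basis.repr_self, Finsupp.single_apply]
  rw [← Module.Basis.coord_apply, ← h, LinearMap.flip_apply, hu]
  simp

/-- By skew-symmetry, all iterated residues are determined by those along multiindices. -/
theorem pairing_flip_injective (k : Fin r → ℕ) : Function.Injective (pairing k).flip := by
  rw [← LinearMap.ker_eq_bot, LinearMap.ker_eq_bot']
  intro x hx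
  apply Subtype.ext
  refine eq_zero_of_iteratedResidue (natCard_symbols k) _ fun σ => ?_
  obtain ⟨J, π, rfl⟩ := exists_vertices_trans_eq σ
  have hJ : iteratedResidue (size k) J.vertices x.1 = 0 := by
    have h : J.sgn * iteratedResidue (size k) J.vertices x.1 = 0 := by
      rw [← pairing_monomialBasis]
      exact LinearMap.congr_fun hx (monomialBasis k J)
    exact (mul_eq_zero.1 h).resolve_left (left_ne_zero_of_mul_eq_one J.sgn_mul_self)
  -- Skew-symmetry moves `π` from the enumeration to `x`, at the price of a sign.
  have hx' : x.1 = permSign π • groupAct π x.1 := by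
    rw [x.2 π, smul_smul, permSign_mul_self, one_smul]
  rw [hx', map_smul, groupAct, iteratedResidue_act (natCard_symbols k), hJ, smul_zero]

theorem pairing_isPerfPair (k : Fin r → ℕ) : (pairing k).IsPerfPair :=
  LinearMap.IsPerfPair.of_injective (pairing_injective k) (pairing_flip_injective k)

theorem dualBasis_monomialBasis (h : (pairing k).IsPerfPair) (J : Multiindex k) :
    dualBasis (pairing k) h (monomialBasis k) J = J.sgn • asym (stringTree J.vertices).cls := by
  apply pairing_flip_injective k
  refine (monomialBasis k).ext fun K => ?_
  rw [LinearMap.flip_apply, LinearMap.flip_apply, apply_dualBasis, pairing_asym_stringTree]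
  congr

end

end StringTrees

theorem mainTheorem5 (r : ℕ) (k : Fin r → ℕ) :
    ∃ h : (pairing k).IsPerfPair,
      Omega k h =
        ∑ J : Multiindex k,
          (J.sgn • asym (stringTree J.vertices).cls) ⊗ₜ[ℂ] monomialBasis k J ∧
      ∀ J : Multiindex k,
        dualBasis (pairing k) h (monomialBasis k) J =
          J.sgn • asym (stringTree J.vertices).cls := by
  refine ⟨pairing_isPerfPair k, ?_, dualBasis_monomialBasis _⟩
  rw [Omega, canonicalElement_eq_sum _ _ (monomialBasis k)]
  exact Finset.sum_congr rfl fun J _ => by rw [dualBasis_monomialBasis]
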